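/- Let $N$ be a finite set and let $f_M,f_C\colon 2^N\to\mathbb{Z}$ be supermodular set functions with $f_M(\emptyset)=f_C(\emptyset)=0$; write $f_E=f_M+f_C$ and $x(X)=\sum_{i\in X}x_i$. For a set function $f$ let $$\bar{\mathbf B}(f)=\{x\in\mathbb{R}^N : x(N)=f(N),\ x(X)\ge f(X)\ \text{for all } X\subseteq N\},\qquad \ddot{\mathbf B}(f)=\bar{\mathbf B}(f)\cap\mathbb{Z}^N .$$ Let $\mathbf B_E=\{x+y : x\in\ddot{\mathbf B}(f_M),\ y\in\bar{\mathbf B}(f_C)\}$ be the mixed set, so that $\ddot{\mathbf B}_E=\mathbf B_E\cap\mathbb{Z}^N$ is the M-convex set $\ddot{\mathbf B}(f_E)$ of $f_E$. For $\beta\in\mathbb{Z}$ let $\mathrm L(\beta)$ be the smallest (with respect to inclusion) maximizer of $X\mapsto f_E(X)-\beta|X|$ over $X\subseteq N$. The essential values $\beta_1>\beta_2>\dots>\beta_q$ of $\ddot{\mathbf B}_E$ are the integers $\beta$ with $\mathrm L(\beta)\neq \mathrm L(\beta-1)$, and its canonical partition $N_1,\dots,N_q$ of $N$ is given by $N_j=\mathrm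 L(\beta_j-1)\setminus \mathrm L(\beta_j)$. Let $\Phi\colon\mathbb{R}^N\to\mathbb{R}$ be symmetric (invariant under permutations of the coordinates) and strictly convex, and let $z^*\in\mathbf B_E$ be any minimizer of $\Phi$ over $\mathbf B_E$. Then for each $j=1,\dots,q$, $$\beta_j-1\le z^*_i\le\beta_j\qquad\text{for every } i\in N_j .$$ -/

import Mathlib

/-- Supermodularity of an integer-valued set function on the subsets of `N`. -/
def IsSupermodular {N : Type*} [DecidableEq N] (f : Finset N → ℤ) : Prop :=
  ∀ X Y : Finset N, f X + f Y ≤ f (X ∪ Y) + f (X ∩ Y)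

/-- The integral base-polyhedron of `f`: the real vectors `x` with `x(N) = f(N)` and
`x(X) ≥ f(X)` for all `X ⊆ N`. -/
def basePolyhedron {N : Type*} [Fintype N] (f : Finset N → ℤ) : Set (N → ℝ) :=
  {x | ∑ i, x i = (f Finset.univ : ℝ) ∧ ∀ X : Finset N, (f X : ℝ) ≤ ∑ i ∈ X, x i}

/-- The integer vectors `ℤ^N` inside `ℝ^N`. -/
def integerVectors (N : Type*) : Set (N → ℝ) :=
  {x | ∀ i, ∃ k : ℤ, x i = (k : ℝ)}

/-- The M-convex set of `f`: the integer vectors in its base-polyhedron. -/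
def mConvexSet {N : Type*} [Fintype N] (f : Finset N → ℤ) : Set (N → ℝ) :=
  basePolyhedron f ∩ integerVectors N

/-- The mixed set: the Minkowski sum of the M-convex set of `fM` and the integral base-polyhedron
of `fC`. -/
def mixedSet {N : Type*} [Fintype N] (fM fC : Finset N → ℤ) : Set (N → ℝ) :=
  {z | ∃ x ∈ mConvexSet fM, ∃ y ∈ basePolyhedron fC, z = x + y}

/-- `Φ` is invariant under all permutations of the coordinates. -/
def IsSymmetric {N : Type*} (Φ : (N → ℝ) → ℝ) : Prop :=
  ∀ (σ : Equiv.Perm N) (z : N → ℝ), Φ (fun i => z (σ i)) = Φ z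

/-- The family of all maximizers `X ⊆ N` of `f(X) - β|X|`. -/
def maximizers {N : Type*} (f : Finset N → ℤ) (β : ℤ) : Set (Finset N) :=
  {X | ∀ Y : Finset N, f Y - β * (Y.card : ℤ) ≤ f X - β * (X.card : ℤ)}

open Classical in
/-- The intersection of all maximizers of `f(X) - β|X|`. For supermodular `f` it is itself a
maximizer, hence the smallest one (see `isLeast_smallestMaximizer`). -/
noncomputable def smallestMaximizer {N : Type*} [Fintype N] (f : Finset N → ℤ) (β : ℤ) :
    Finset N :=
  Finset.univ.filter (fun i => ∀ X ∈ maximizers f β, i ∈ X)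

/-- The essential values of `f`: the integers at which the smallest maximizer changes. -/
def essentialValues {N : Type*} [Fintype N] (f : Finset N → ℤ) : Set ℤ :=
  {β | smallestMaximizer f β ≠ smallestMaximizer f (β - 1)}

/-- The member of the canonical partition of `f` that belongs to the essential value `β`. -/
noncomputable def canonicalPart {N : Type*} [Fintype N] [DecidableEq N] (f : Finset N → ℤ)
    (β : ℤ) : Finset N :=
  smallestMaximizer f (β - 1) \ smallestMaximizer f β

theorem inter_mem_maximizers {N : Type*} [DecidableEq N] {f : Finset N → ℤ}
    (hf : IsSupermodular f) {β : ℤ} {X Y : Finset N}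
    (hX : X ∈ maximizers f β) (hY : Y ∈ maximizers f β) : X ∩ Y ∈ maximizers f β := by
  intro Z
  have h1 := hf X Y
  have h2 := hX (X ∪ Y)
  have h3 := hY Z
  have h4 : ((X ∪ Y).card : ℤ) + ((X ∩ Y).card : ℤ) = X.card + Y.card := by
    exact_mod_cast Finset.card_union_add_card_inter X Y
  have h5 : β * ((X ∪ Y).card : ℤ) + β * ((X ∩ Y).card : ℤ) = β * X.card + β * Y.card := by
    rw [← mul_add, h4, mul_add]
  linarith

/-- For supermodular `f`, `smallestMaximizer f β` is the smallest maximizer of `f(X) - β|X|`. -/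
theorem isLeast_smallestMaximizer {N : Type*} [Fintype N] [DecidableEq N] {f : Finset N → ℤ}
    (hf : IsSupermodular f) (β : ℤ) :
    IsLeast (maximizers f β) (smallestMaximizer f β) := by
  have hne : (maximizers f β).Nonempty := by
    obtain ⟨X, -, hX⟩ := Finset.exists_max_image (Finset.univ : Finset (Finset N))
      (fun X => f X - β * (X.card : ℤ)) Finset.univ_nonempty
    exact ⟨X, fun Y => hX Y (Finset.mem_univ Y)⟩
  obtain ⟨X, hX, hmin⟩ := (Set.toFinite (maximizers f β)).exists_minimalFor Finset.card _ hne
  have hle : ∀ Y ∈ maximizers f β, X ⊆ Y := by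
    intro Y hY
    have h1 := hmin (inter_mem_maximizers hf hX hY)
      (Finset.card_le_card Finset.inter_subset_left)
    have h2 := Finset.eq_of_subset_of_card_le Finset.inter_subset_left h1
    exact Finset.inter_eq_left.mp h2
  have heq : smallestMaximizer f β = X := by
    ext i
    simp only [smallestMaximizer, Finset.mem_filter, Finset.mem_univ, true_and]
    exact ⟨fun h => h X hX, fun h Y hY => hle Y hY h⟩
  rw [heq]
  exact ⟨hX, fun Y hY => hle Y hY⟩

theorem smallestMaximizer_anti {N : Type*} [Fintype N] [DecidableEq N] {f : Finset N → ℤ}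
    (hf : IsSupermodular f) {β γ : ℤ} (h : β ≤ γ) :
    smallestMaximizer f γ ⊆ smallestMaximizer f β := by
  rcases h.eq_or_lt with rfl | h
  · exact subset_rfl
  obtain ⟨hA, hAl⟩ := isLeast_smallestMaximizer hf γ
  obtain ⟨hB, -⟩ := isLeast_smallestMaximizer hf β
  set A := smallestMaximizer f γ
  set B := smallestMaximizer f β
  have hI : A ∩ B ∈ maximizers f γ := by
    intro Z
    have h1 := hf A B
    have h2 := hB (A ∪ B)
    have h3 := hA Z
    have h4 : ((A ∪ B).card : ℤ) + ((A ∩ B).card : ℤ) = A.card + B.card := by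
      exact_mod_cast Finset.card_union_add_card_inter A B
    have h5 : (0 : ℤ) ≤ (A ∪ B).card - B.card := by
      have : (B.card : ℤ) ≤ (A ∪ B).card := by
        exact_mod_cast Finset.card_le_card Finset.subset_union_right
      linarith
    have h6 := mul_le_mul_of_nonneg_right h.le h5
    have h7 : γ * ((A ∩ B).card : ℤ) = γ * (A.card : ℤ) - γ * ((A ∪ B).card - B.card) := by
      rw [eq_sub_of_add_eq' h4]
      ring
    linarith
  exact (Finset.subset_inter_iff.mp (hAl hI)).2

/-- The sets `canonicalPart f β`, for `β` an essential value, form a partition of `N`. -/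
theorem canonicalPart_partition {N : Type*} [Fintype N] [DecidableEq N] {f : Finset N → ℤ}
    (hf : IsSupermodular f) :
    (∀ β ∈ essentialValues f, (canonicalPart f β).Nonempty) ∧
      ∀ i : N, ∃! β : ℤ, β ∈ essentialValues f ∧ i ∈ canonicalPart f β := by
  refine ⟨fun β hβ => ?_, fun i => ?_⟩
  · rw [Finset.nonempty_iff_ne_empty]
    intro h
    exact hβ (subset_antisymm (smallestMaximizer_anti hf (by omega))
      (Finset.sdiff_eq_empty_iff_subset.mp h))
  obtain ⟨K, hK⟩ : ∃ K : ℤ, ∀ X Y : Finset N, f X - f Y ≤ K := by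
    obtain ⟨p, -, hp⟩ := Finset.exists_max_image
      (Finset.univ : Finset (Finset N × Finset N)) (fun p => f p.1 - f p.2) Finset.univ_nonempty
    exact ⟨f p.1 - f p.2, fun X Y => hp (X, Y) (Finset.mem_univ _)⟩
  have hK0 : 0 ≤ K := by simpa using hK ∅ ∅
  have hlow : i ∈ smallestMaximizer f (-(K + 1)) := by
    have hm := (isLeast_smallestMaximizer hf (-(K + 1))).1
    by_contra hi
    have h1 := hm Finset.univ
    have h2 := hK (smallestMaximizer f (-(K + 1))) Finset.univ
    have h3 : ((smallestMaximizer f (-(K + 1))).card : ℤ) + 1 ≤ (Finset.univ : Finset N).card := by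
      exact_mod_cast Finset.card_lt_card (Finset.ssubset_univ_iff.mpr
        (fun h => hi (by rw [h]; exact Finset.mem_univ i)))
    nlinarith
  have hhigh : ∀ β : ℤ, i ∈ smallestMaximizer f β → β ≤ K := by
    intro β hi
    by_contra hlt
    have hm := (isLeast_smallestMaximizer hf β).1
    have h1 := hm ∅
    have h2 := hK (smallestMaximizer f β) ∅
    have h3 : (1 : ℤ) ≤ (smallestMaximizer f β).card := by
      exact_mod_cast Finset.card_pos.mpr ⟨i, hi⟩
    simp only [Finset.card_empty, Nat.cast_zero, mul_zero, sub_zero] at h1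
    nlinarith
  obtain ⟨b, hb, hbmax⟩ := Int.exists_greatest_of_bdd
    (P := fun β => i ∈ smallestMaximizer f β) ⟨K, hhigh⟩ ⟨_, hlow⟩
  have hnot : i ∉ smallestMaximizer f (b + 1) := fun h => by
    have := hbmax _ h
    omega
  refine ⟨b + 1, ⟨?_, ?_⟩, ?_⟩
  · intro h
    rw [add_sub_cancel_right] at h
    exact hnot (h ▸ hb)
  · rw [canonicalPart, add_sub_cancel_right]
    exact Finset.mem_sdiff.mpr ⟨hb, hnot⟩
  · rintro γ ⟨-, hγ⟩
    obtain ⟨h1, h2⟩ := Finset.mem_sdiff.mp hγ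
    have h3 := hbmax _ h1
    have h4 : b < γ := by
      by_contra h5
      exact h2 (smallestMaximizer_anti hf (by omega) hb)
    omega

/-- An integral sandwich theorem: between a supermodular and a submodular function lies an integral
modular one. -/
theorem exists_int_between {N : Type*} [DecidableEq N] (S : Finset N) :
    ∀ f h : Finset N → ℤ,
      (∀ X ⊆ S, ∀ Y ⊆ S, f X + f Y ≤ f (X ∪ Y) + f (X ∩ Y)) →
      (∀ X ⊆ S, ∀ Y ⊆ S, h (X ∪ Y) + h (X ∩ Y) ≤ h X + h Y) →
      f ∅ = 0 → h ∅ = 0 → (∀ X ⊆ S, f X ≤ h X) →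
      ∃ x : N → ℤ, ∀ X ⊆ S, f X ≤ ∑ i ∈ X, x i ∧ ∑ i ∈ X, x i ≤ h X := by
  induction S using Finset.induction_on with
  | empty =>
    intro f h _ _ hf0 hh0 _
    refine ⟨0, fun X hX => ?_⟩
    rw [Finset.subset_empty.mp hX]
    simp [hf0, hh0]
  | insert s S hs ih =>
    intro f h hf hh hf0 hh0 hfh
    obtain ⟨A, hA, hAmax⟩ := Finset.exists_max_image S.powerset
      (fun X => f (insert s X) - h X) ⟨∅, Finset.empty_mem_powerset S⟩
    rw [Finset.mem_powerset] at hA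
    set t : ℤ := f (insert s A) - h A with ht
    have up : ∀ X ⊆ S, X ⊆ insert s S := fun X hX => hX.trans (Finset.subset_insert s S)
    have upi : ∀ X ⊆ S, insert s X ⊆ insert s S := fun X hX => Finset.insert_subset_insert s hX
    have nm : ∀ X ⊆ S, s ∉ X := fun X hX h => hs (hX h)
    have lo : ∀ X ⊆ S, f (insert s X) - h X ≤ t := fun X hX =>
      hAmax X (Finset.mem_powerset.mpr hX)
    have u1 : ∀ X Y : Finset N, insert s X ∪ Y = insert s (X ∪ Y) := fun X Y =>
      Finset.insert_union s X Y
    have u2 : ∀ X Y : Finset N, X ∪ insert s Y = insert s (X ∪ Y) := fun X Y =>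
      Finset.union_insert s X Y
    have u3 : ∀ X Y : Finset N, insert s X ∪ insert s Y = insert s (X ∪ Y) := fun X Y => by
      ext; simp only [Finset.mem_union, Finset.mem_insert]; tauto
    have n1 : ∀ X, ∀ Y ⊆ S, insert s X ∩ Y = X ∩ Y := fun X Y hY =>
      Finset.insert_inter_of_notMem (nm Y hY)
    have n2 : ∀ X ⊆ S, ∀ Y, X ∩ insert s Y = X ∩ Y := fun X hX Y =>
      Finset.inter_insert_of_notMem (nm X hX)
    have n3 : ∀ X Y : Finset N, insert s X ∩ insert s Y = insert s (X ∩ Y) := fun X Y =>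
      (Finset.insert_inter_distrib X Y s).symm
    have hi : ∀ Y ⊆ S, t ≤ h (insert s Y) - f Y := by
      intro Y hY
      have a1 := hf _ (upi A hA) _ (up Y hY)
      have a2 := hh _ (up A hA) _ (upi Y hY)
      rw [u1, n1 _ _ hY] at a1
      rw [u2, n2 _ hA] at a2
      have a3 := hfh _ (upi _ (Finset.union_subset hA hY))
      have a4 := hfh _ (up (A ∩ Y) (Finset.inter_subset_left.trans hA))
      linarith
    have key := ih (fun X => max (f X) (f (insert s X) - t))
      (fun X => min (h X) (h (insert s X) - t)) ?_ ?_ ?_ ?_ ?_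
    · obtain ⟨x, hx⟩ := key
      refine ⟨Function.update x s t, fun X hX => ?_⟩
      by_cases hsX : s ∈ X
      · have hE : X.erase s ⊆ S := by
          intro i hi
          obtain ⟨h1, h2⟩ := Finset.mem_erase.mp hi
          exact (Finset.mem_insert.mp (hX h2)).resolve_left h1
        have e1 : ∑ i ∈ X, Function.update x s t i = t + ∑ i ∈ X.erase s, x i := by
          rw [← Finset.add_sum_erase X _ hsX, Function.update_self]
          congr 1
          exact Finset.sum_congr rfl fun i hi =>
            Function.update_of_ne (Finset.ne_of_mem_erase hi) _ _
        obtain ⟨b1, b2⟩ := hx _ hE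
        simp only [Finset.insert_erase hsX] at b1 b2
        have c1 := le_max_right (f (X.erase s)) (f X - t)
        have c2 := min_le_right (h (X.erase s)) (h X - t)
        rw [e1]
        constructor <;> linarith
      · have hE : X ⊆ S := fun i hiX =>
          (Finset.mem_insert.mp (hX hiX)).resolve_left (by rintro rfl; exact hsX hiX)
        have e1 : ∑ i ∈ X, Function.update x s t i = ∑ i ∈ X, x i :=
          Finset.sum_congr rfl fun i hiX =>
            Function.update_of_ne (by rintro rfl; exact hsX hiX) _ _
        obtain ⟨b1, b2⟩ := hx _ hE
        rw [e1]
        exact ⟨(le_max_left _ _).trans b1, b2.trans (min_le_left _ _)⟩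
    · intro X hX Y hY
      have a1 := hf _ (up X hX) _ (up Y hY)
      have a2 := hf _ (upi X hX) _ (up Y hY)
      have a3 := hf _ (up X hX) _ (upi Y hY)
      have a4 := hf _ (upi X hX) _ (upi Y hY)
      rw [u1, n1 _ _ hY] at a2
      rw [u2, n2 _ hX] at a3
      rw [u3, n3] at a4
      grind
    · intro X hX Y hY
      have a1 := hh _ (up X hX) _ (up Y hY)
      have a2 := hh _ (upi X hX) _ (up Y hY)
      have a3 := hh _ (up X hX) _ (upi Y hY)
      have a4 := hh _ (upi X hX) _ (upi Y hY)
      rw [u1, n1 _ _ hY] at a2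
      rw [u2, n2 _ hX] at a3
      rw [u3, n3] at a4
      grind
    · have := lo ∅ (Finset.empty_subset S)
      rw [hf0, max_eq_left]
      linarith
    · have := hi ∅ (Finset.empty_subset S)
      rw [hh0, min_eq_left]
      linarith
    · intro X hX
      have b1 := lo X hX
      have b2 := hi X hX
      have b3 := hfh X (up X hX)
      have b4 := hfh _ (upi X hX)
      grind

/-- The set of integer vectors of the mixed set is the M-convex set of `fM + fC`. Hence the
essential values and the canonical partition of that M-convex set are those of `fM + fC`. -/
theorem mixedSet_inter_integerVectors {N : Type*} [Fintype N] [DecidableEq N]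
    {fM fC : Finset N → ℤ} (hM : IsSupermodular fM) (hM0 : fM ∅ = 0)
    (hC : IsSupermodular fC) (hC0 : fC ∅ = 0) :
    mixedSet fM fC ∩ integerVectors N = mConvexSet (fun X => fM X + fC X) := by
  ext z
  constructor
  · rintro ⟨⟨x, ⟨⟨hx1, hx2⟩, -⟩, y, ⟨hy1, hy2⟩, rfl⟩, hz⟩
    refine ⟨⟨?_, fun X => ?_⟩, hz⟩
    · simp only [Pi.add_apply, Finset.sum_add_distrib, hx1, hy1, Int.cast_add]
    · simp only [Pi.add_apply, Finset.sum_add_distrib, Int.cast_add]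
      exact add_le_add (hx2 X) (hy2 X)
  · rintro ⟨⟨hz1, hz2⟩, hz⟩
    refine ⟨?_, hz⟩
    choose k hk using hz
    have hk' : ∀ X : Finset N, ∑ i ∈ X, z i = ((∑ i ∈ X, k i : ℤ) : ℝ) := fun X => by
      rw [Int.cast_sum]
      exact Finset.sum_congr rfl fun i _ => hk i
    have hk1 : ∑ i, k i = fM Finset.univ + fC Finset.univ := by
      have := hz1
      rw [hk'] at this
      exact_mod_cast this
    have hk2 : ∀ X : Finset N, fM X + fC X ≤ ∑ i ∈ X, k i := fun X => by
      have := hz2 X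
      rw [hk'] at this
      exact_mod_cast this
    obtain ⟨x, hx⟩ := exists_int_between (Finset.univ : Finset N) fM
      (fun X => ∑ i ∈ X, k i - fC X) (fun X _ Y _ => hM X Y)
      (fun X _ Y _ => by
        have := hC X Y
        have := Finset.sum_union_inter (f := k) (s₁ := X) (s₂ := Y)
        linarith) hM0 (by simp [hC0]) (fun X _ => by linarith [hk2 X])
    have hx1 := fun X => (hx X (Finset.subset_univ X)).1
    have hx2 := fun X => (hx X (Finset.subset_univ X)).2
    have hxu : ∑ i, x i = fM Finset.univ :=
      le_antisymm (by linarith [hx2 Finset.univ]) (hx1 Finset.univ)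
    refine ⟨fun i => (x i : ℝ), ⟨⟨?_, fun X => ?_⟩, fun i => ⟨x i, rfl⟩⟩,
      fun i => ((k i - x i : ℤ) : ℝ), ⟨?_, fun X => ?_⟩, ?_⟩
    · dsimp only
      exact_mod_cast hxu
    · dsimp only
      exact_mod_cast hx1 X
    · rw [← Int.cast_sum, Finset.sum_sub_distrib, hk1, hxu, add_sub_cancel_left]
    · rw [← Int.cast_sum, Finset.sum_sub_distrib]
      exact_mod_cast by linarith [hx2 X]
    · funext i
      rw [hk i]
      simp

/-! Write L(γ) for the smallest maximizer of f_E(X) - γ|X|. It suffices that for every integer γ,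
L(γ) contains {z > γ} and misses {z < γ}: membership of i in L(β-1) then gives z_i ≥ β-1, and
absence from L(β) gives z_i ≤ β.

By `separates_of_mem_maximizers`, this holds once some set tight for f_E at z separates {z > γ} from
{z < γ}. `exists_tight_level` supplies that set. With z = x + y, continuous exchanges in y show that
U = {z > γ} and P = {z ≥ γ} are tight for f_C at y. On W = P \ U the sum is the integer γ, so
subtracting the fixed integer vector x off W leaves an integral point of a smaller mixed system. If
its tight sets do not separate U from the complement of P, integrality allows a whole unit to move
from some i in U to some j outside P.

The integral sandwich theorem splits the moved point into a new x' and a new continuous part on W.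
`exists_raise` and `exists_lower` compensate for the unit jumps of x' at i and j, and
`replace_mem_basePolyhedron` glues the pieces. Every coordinate of the new point lies weakly between
γ and its old value, and coordinate i changes, so `apply_lt_of_contract` contradicts minimality. -/

/-! ### Slacks, transfers and strict convexity -/

/-- The sets on which the constraint of the base-polyhedron of `f` holds with equality at `y`. -/
def tightSets {N : Type*} (f : Finset N → ℤ) (y : N → ℝ) : Set (Finset N) :=
  {X | ∑ i ∈ X, y i = (f X : ℝ)}

/-- The vector obtained from `y` by moving the amount `δ` from the coordinate `i` to `j`. -/
def transfer {N : Type*} [DecidableEq N] (y : N → ℝ) (i j : N) (δ : ℝ) : N → ℝ :=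
  fun k => y k + (if j = k then δ else 0) - (if i = k then δ else 0)

theorem sum_transfer {N : Type*} [DecidableEq N] (y : N → ℝ) (i j : N) (δ : ℝ) (X : Finset N) :
    ∑ k ∈ X, transfer y i j δ k =
      ∑ k ∈ X, y k + (if j ∈ X then δ else 0) - (if i ∈ X then δ else 0) := by
  simp only [transfer, Finset.sum_sub_distrib, Finset.sum_add_distrib, Finset.sum_ite_eq]

/-- The sum of y is modular, so subtracting a supermodular function leaves a submodular slack.
Slacks are nonnegative on the base-polyhedron, hence its tight sets form a lattice. -/
theorem IsSupermodular.slack_le {N : Type*} [DecidableEq N] {f : Finset N → ℤ}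
    (hf : IsSupermodular f) (y : N → ℝ) (X Y : Finset N) :
    (∑ i ∈ X ∪ Y, y i - f (X ∪ Y)) + (∑ i ∈ X ∩ Y, y i - f (X ∩ Y)) ≤
      (∑ i ∈ X, y i - f X) + (∑ i ∈ Y, y i - f Y) := by
  have h1 : (f X : ℝ) + f Y ≤ f (X ∪ Y) + f (X ∩ Y) := by exact_mod_cast hf X Y
  have h2 := Finset.sum_union_inter (f := y) (s₁ := X) (s₂ := Y)
  linarith

theorem isClosed_basePolyhedron {N : Type*} [Fintype N] (f : Finset N → ℤ) : IsClosed (basePolyhedron f) := by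
  have h : basePolyhedron f = {x | ∑ i, x i = (f Finset.univ : ℝ)} ∩
      ⋂ X : Finset N, {x | (f X : ℝ) ≤ ∑ i ∈ X, x i} := by
    ext x
    simp [basePolyhedron]
  rw [h]
  exact (isClosed_eq (by fun_prop) continuous_const).inter
    (isClosed_iInter fun X => isClosed_le continuous_const (by fun_prop))

/-- Moving an amount from a larger coordinate to a smaller one, without interchanging their order,
decreases a symmetric strictly convex function. -/
theorem apply_transfer_lt {N : Type*} [DecidableEq N] {Φ : (N → ℝ) → ℝ} (hsymm : IsSymmetric Φ)
    (hconv : StrictConvexOn ℝ Set.univ Φ) {z : N → ℝ} {i j : N} {δ : ℝ} (hδ : 0 < δ)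
    (h : δ < z i - z j) : Φ (transfer z i j δ) < Φ z := by
  have hpos : 0 < z i - z j := hδ.trans h
  have hij : i ≠ j := by
    rintro rfl
    simp at hpos
  set s := δ / (z i - z j) with hs
  have hs0 : 0 < s := div_pos hδ hpos
  have hs1 : s < 1 := (div_lt_one hpos).mpr h
  have hsd : s * (z i - z j) = δ := div_mul_cancel₀ _ hpos.ne'
  have hne : z ≠ fun k => z (Equiv.swap i j k) := fun he => by
    have := congrFun he i
    simp only [Equiv.swap_apply_left] at this
    linarith
  have hlt := hconv.2 (Set.mem_univ z) (Set.mem_univ _) hne (sub_pos.mpr hs1) hs0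
    (sub_add_cancel 1 s)
  -- The transfer is a proper convex combination of z and z with coordinates i and j swapped; Φ
  -- agrees at these two distinct points.
  have heq : transfer z i j δ = (1 - s) • z + s • fun k => z (Equiv.swap i j k) := by
    funext k
    simp only [transfer, Pi.add_apply, Pi.smul_apply, smul_eq_mul]
    by_cases hki : k = i
    · subst hki
      simp only [hij.symm, if_false, if_true, Equiv.swap_apply_left]
      linarith
    · by_cases hkj : k = j
      · subst hkj
        simp only [hij, if_false, if_true, Equiv.swap_apply_right]
        linarith
      · simp only [Ne.symm hki, Ne.symm hkj, if_false, Equiv.swap_apply_of_ne_of_ne hki hkj]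
        ring
  rw [heq]
  refine hlt.trans_eq ?_
  rw [hsymm]
  simp only [smul_eq_mul]
  ring

/-! ### The lattice of tight sets and feasible exchanges -/

section

variable {N : Type*} [Fintype N] [DecidableEq N] {f : Finset N → ℤ} {y : N → ℝ}

theorem union_mem_tightSets (hf : IsSupermodular f) (hy : y ∈ basePolyhedron f) {X Y : Finset N}
    (hX : X ∈ tightSets f y) (hY : Y ∈ tightSets f y) : X ∪ Y ∈ tightSets f y := by
  have h1 := hf.slack_le y X Y
  have h2 := hy.2 (X ∪ Y)
  have h3 := hy.2 (X ∩ Y)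
  simp only [tightSets, Set.mem_ofPred_eq] at *
  linarith

theorem inter_mem_tightSets (hf : IsSupermodular f) (hy : y ∈ basePolyhedron f) {X Y : Finset N}
    (hX : X ∈ tightSets f y) (hY : Y ∈ tightSets f y) : X ∩ Y ∈ tightSets f y := by
  have h1 := hf.slack_le y X Y
  have h2 := hy.2 (X ∪ Y)
  have h3 := hy.2 (X ∩ Y)
  simp only [tightSets, Set.mem_ofPred_eq] at *
  linarith

/-- If tight sets separate each point of `A` from each point of `B`, then one tight set separates
`A` from `B`. -/
theorem exists_tight_separating (hf : IsSupermodular f) (hf0 : f ∅ = 0)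
    (hy : y ∈ basePolyhedron f) (A B : Finset N)
    (h : ∀ i ∈ A, ∀ j ∈ B, ∃ X ∈ tightSets f y, i ∈ X ∧ j ∉ X) :
    ∃ X ∈ tightSets f y, A ⊆ X ∧ Disjoint X B := by
  -- Intersect over the points of B to isolate a single i, then take unions over A.
  have hpt : ∀ i ∈ A, ∃ X ∈ tightSets f y, i ∈ X ∧ Disjoint X B := by
    intro i hi
    have h' := h i hi
    clear h
    induction B using Finset.induction_on with
    | empty => exact ⟨Finset.univ, hy.1, Finset.mem_univ i, Finset.disjoint_empty_right _⟩
    | insert b B _ ih =>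
      obtain ⟨X, hX, hiX, hXB⟩ := ih fun j hj => h' j (Finset.mem_insert_of_mem hj)
      obtain ⟨Y, hY, hiY, hbY⟩ := h' b (Finset.mem_insert_self b B)
      refine ⟨X ∩ Y, inter_mem_tightSets hf hy hX hY, Finset.mem_inter.mpr ⟨hiX, hiY⟩, ?_⟩
      rw [Finset.disjoint_insert_right]
      exact ⟨fun hb => hbY (Finset.mem_inter.mp hb).2,
        hXB.mono_left Finset.inter_subset_left⟩
  clear h
  induction A using Finset.induction_on with
  | empty => exact ⟨∅, by simp [tightSets, hf0], subset_rfl, Finset.disjoint_empty_left _⟩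
  | insert a A _ ih =>
    obtain ⟨X, hX, hAX, hXB⟩ := ih fun i hi => hpt i (Finset.mem_insert_of_mem hi)
    obtain ⟨Y, hY, haY, hYB⟩ := hpt a (Finset.mem_insert_self a A)
    refine ⟨X ∪ Y, union_mem_tightSets hf hy hX hY, ?_, Finset.disjoint_union_left.mpr ⟨hXB, hYB⟩⟩
    exact Finset.insert_subset (Finset.mem_union_right _ haY)
      (hAX.trans Finset.subset_union_left)

/-- Only sets containing i but not j lose mass, so only their slacks matter. -/
theorem transfer_mem_basePolyhedron (hy : y ∈ basePolyhedron f) {i j : N} {δ : ℝ} (hδ : 0 ≤ δ)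
    (h : ∀ X : Finset N, i ∈ X → j ∉ X → f X + δ ≤ ∑ k ∈ X, y k) :
    transfer y i j δ ∈ basePolyhedron f := by
  refine ⟨?_, fun X => ?_⟩
  · rw [sum_transfer]
    simp [hy.1]
  · rw [sum_transfer]
    have h1 := hy.2 X
    by_cases hi : i ∈ X <;> by_cases hj : j ∈ X
    · simpa [hi, hj] using h1
    · have := h X hi hj
      simp only [hi, hj, if_true, if_false]
      linarith
    · simp only [hi, hj, if_true, if_false]
      linarith
    · simpa [hi, hj] using h1

/-- The finitely many sets containing i but not j all have positive slack; the least of these is an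
admissible ε. -/
theorem exists_transfer_mem_basePolyhedron (hy : y ∈ basePolyhedron f) {i j : N} (hij : i ≠ j)
    (h : ¬ ∃ X ∈ tightSets f y, i ∈ X ∧ j ∉ X) :
    ∃ ε > 0, ∀ δ, 0 ≤ δ → δ ≤ ε → transfer y i j δ ∈ basePolyhedron f := by
  obtain ⟨X, hX, hmin⟩ := Finset.exists_min_image
    (Finset.univ.filter fun X : Finset N => i ∈ X ∧ j ∉ X) (fun X => ∑ k ∈ X, y k - f X)
    ⟨{i}, by simp [hij.symm]⟩
  simp only [Finset.mem_filter, Finset.mem_univ, true_and] at hX hmin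
  refine ⟨∑ k ∈ X, y k - f X, ?_, fun δ h0 hδ =>
    transfer_mem_basePolyhedron hy h0 fun Y hi hj => ?_⟩
  · rw [gt_iff_lt, sub_pos]
    exact lt_of_le_of_ne (hy.2 X) fun he => h ⟨X, he.symm, hX⟩
  · have := hmin Y ⟨hi, hj⟩
    linarith

/-! ### Integral adjustment of one coordinate -/

/-- Inside a tight set `U` on which `y` exceeds an integer vector `a`, the coordinate `y i` can be
raised to at least `a i + 1` while the other coordinates only decrease and stay above `a`. -/
theorem exists_raise (hf : IsSupermodular f) (hf0 : f ∅ = 0) (hy : y ∈ basePolyhedron f)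
    {U : Finset N} (hU : U ∈ tightSets f y) (a : N → ℤ) (ha : ∀ k ∈ U, (a k : ℝ) < y k)
    {i : N} (hi : i ∈ U) :
    ∃ w ∈ basePolyhedron f, (∀ k ∉ U, w k = y k) ∧
      (∀ k ∈ U, k ≠ i → (a k : ℝ) ≤ w k ∧ w k ≤ y k) ∧
      (a i : ℝ) + 1 ≤ w i ∧ w i < y i + 1 := by
  rcases le_or_gt ((a i : ℝ) + 1) (y i) with hyi | hyi
  · exact ⟨y, hy, fun _ _ => rfl, fun k hk _ => ⟨(ha k hk).le, le_rfl⟩, hyi, by linarith⟩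
  -- The box freezes coordinates outside U, lets those in U other than i fall as far as a, and caps
  -- coordinate i at a i + 1. The witness maximizes coordinate i over this box.
  set lo : N → ℝ := fun k => if k = i then y i else if k ∈ U then a k else y k with hlo
  set hi' : N → ℝ := fun k => if k = i then a i + 1 else y k with hhi
  have hcomp : IsCompact (basePolyhedron f ∩ Set.Icc lo hi') :=
    isCompact_Icc.inter_left (isClosed_basePolyhedron f)
  have hyK : y ∈ basePolyhedron f ∩ Set.Icc lo hi' := by
    refine ⟨hy, fun k => ?_, fun k => ?_⟩
    · simp only [hlo]
      split_ifs with h1 h2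
      · rw [h1]
      · exact (ha k h2).le
      · exact le_rfl
    · simp only [hhi]
      split_ifs with h1
      · rw [h1]; exact hyi.le
      · exact le_rfl
  obtain ⟨w, ⟨hw, hwlo, hwhi⟩, hmax⟩ :=
    hcomp.exists_isMaxOn ⟨y, hyK⟩ (continuous_apply i).continuousOn
  have hoff : ∀ k ∉ U, w k = y k := fun k hk => by
    have hki : k ≠ i := fun h => hk (h ▸ hi)
    have h1 := hwlo k
    have h2 := hwhi k
    simp only [hlo, hhi, hki, hk, if_false] at h1 h2
    exact le_antisymm h2 h1
  have hon : ∀ k ∈ U, k ≠ i → (a k : ℝ) ≤ w k ∧ w k ≤ y k := fun k hk hki => by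
    have h1 := hwlo k
    have h2 := hwhi k
    simp only [hlo, hhi, hki, hk, if_false, if_true] at h1 h2
    exact ⟨h1, h2⟩
  have hwi1 : y i ≤ w i := by simpa [hlo] using hwlo i
  have hwi2 : w i ≤ a i + 1 := by simpa [hhi] using hwhi i
  have hai := ha i hi
  refine ⟨w, hw, hoff, hon, ?_, by linarith⟩
  by_contra hlt
  rw [not_le] at hlt
  -- At the maximum, no coordinate still above its bound can give mass to i, so a tight set must
  -- block each such exchange.
  have hsep : ∀ k ∈ U.filter (fun k => k ≠ i ∧ (a k : ℝ) < w k), ∀ j ∈ ({i} : Finset N),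
      ∃ X ∈ tightSets f w, k ∈ X ∧ j ∉ X := by
    intro k hk j hj
    obtain ⟨hkU, hki, hka⟩ := Finset.mem_filter.mp hk
    rw [Finset.mem_singleton] at hj
    subst hj
    by_contra hno
    obtain ⟨ε, hε, hex⟩ := exists_transfer_mem_basePolyhedron hw hki hno
    set δ := min ε (min (w k - a k) (a j + 1 - w j)) with hδ
    have hδ0 : 0 < δ := lt_min hε (lt_min (by linarith) (by linarith))
    have hδ1 : δ ≤ w k - a k := (min_le_right _ _).trans (min_le_left _ _)
    have hδ2 : δ ≤ a j + 1 - w j := (min_le_right _ _).trans (min_le_right _ _)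
    have hmem : transfer w k j δ ∈ basePolyhedron f ∩ Set.Icc lo hi' := by
      refine ⟨hex δ hδ0.le (min_le_left _ _), fun m => ?_, fun m => ?_⟩
      · have h1 := hwlo m
        simp only [hlo, transfer] at h1 ⊢
        by_cases hmj : m = j
        · subst hmj
          simp only [if_true, hki, if_false] at h1 ⊢
          linarith
        · by_cases hmk : m = k
          · subst hmk
            simp only [if_true, hki, hki.symm, hkU, if_false] at h1 ⊢
            linarith
          · simpa [hmj, hmk, Ne.symm hmj, Ne.symm hmk] using h1
      · have h1 := hwhi m
        simp only [hhi, transfer] at h1 ⊢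
        by_cases hmj : m = j
        · subst hmj
          simp only [if_true, hki, if_false] at h1 ⊢
          linarith
        · by_cases hmk : m = k
          · subst hmk
            simp only [if_true, hki, hki.symm, if_false] at h1 ⊢
            linarith
          · simpa [hmj, hmk, Ne.symm hmj, Ne.symm hmk] using h1
    have := hmax hmem
    simp only [Set.mem_ofPred_eq, transfer, if_true, hki, if_false] at this
    linarith
  obtain ⟨X, hX, hAX, hXi⟩ := exists_tight_separating hf hf0 hw _ _ hsep
  rw [Finset.disjoint_singleton_right] at hXi
  have hUw : U ∈ tightSets f w := by
    have h1 := Finset.sum_add_sum_compl U w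
    have h2 := Finset.sum_add_sum_compl U y
    have h3 : ∑ k ∈ Uᶜ, w k = ∑ k ∈ Uᶜ, y k :=
      Finset.sum_congr rfl fun k hk => hoff k (Finset.mem_compl.mp hk)
    have h4 := hy.1
    have h5 := hw.1
    simp only [tightSets, Set.mem_ofPred_eq] at hU ⊢
    linarith
  have hXU := inter_mem_tightSets hf hw hUw hX
  have h1 := Finset.sum_inter_add_sum_sdiff U X w
  have hiD : i ∈ U \ X := Finset.mem_sdiff.mpr ⟨hi, hXi⟩
  have h2 := Finset.add_sum_erase (U \ X) w hiD
  have h3 : ∑ k ∈ (U \ X).erase i, w k = ((∑ k ∈ (U \ X).erase i, a k : ℤ) : ℝ) := by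
    rw [Int.cast_sum]
    refine Finset.sum_congr rfl fun k hk => ?_
    obtain ⟨hki, hk⟩ := Finset.mem_erase.mp hk
    obtain ⟨hkU, hkX⟩ := Finset.mem_sdiff.mp hk
    refine le_antisymm ?_ (hon k hkU hki).1
    by_contra hgt
    exact hkX (hAX (Finset.mem_filter.mpr ⟨hkU, hki, not_le.mp hgt⟩))
  -- On U \ X every coordinate except i equals a, and both U and U ∩ X are tight. Thus w i is an
  -- integer, yet it lies strictly between a i and a i + 1.
  have h4 : w i = ((f U - f (U ∩ X) - ∑ k ∈ (U \ X).erase i, a k : ℤ) : ℝ) := by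
    simp only [tightSets, Set.mem_ofPred_eq] at hUw hXU
    push_cast at h3 ⊢
    linarith
  rw [h4] at hlt hwi1
  have h5 : a i < f U - f (U ∩ X) - ∑ k ∈ (U \ X).erase i, a k := by
    exact_mod_cast hai.trans_le hwi1
  have h6 : f U - f (U ∩ X) - ∑ k ∈ (U \ X).erase i, a k < a i + 1 := by exact_mod_cast hlt
  omega

/-- The set function whose base-polyhedron is the reflection of that of `f` in the origin. -/
def reflection (f : Finset N → ℤ) : Finset N → ℤ :=
  fun X => f Xᶜ - f Finset.univ

theorem IsSupermodular.reflection (hf : IsSupermodular f) : IsSupermodular (reflection f) := by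
  intro X Y
  have := hf Xᶜ Yᶜ
  simp only [_root_.reflection, Finset.compl_union, Finset.compl_inter]
  linarith

/-- As the total is fixed, the bound on X for the reflection is the original bound on the complement
of X. -/
theorem neg_mem_basePolyhedron_reflection (hf0 : f ∅ = 0) :
    -y ∈ basePolyhedron (reflection f) ↔ y ∈ basePolyhedron f := by
  have hc := fun X : Finset N => Finset.sum_add_sum_compl X y
  simp only [basePolyhedron, reflection, Set.mem_ofPred_eq, Pi.neg_apply, Finset.sum_neg_distrib,
    Finset.compl_univ, hf0, zero_sub, Int.cast_neg, neg_inj, Int.cast_sub]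
  refine and_congr_right fun h => ⟨fun h' X => ?_, fun h' X => ?_⟩
  · have h1 := h' Xᶜ
    have h2 := hc X
    rw [compl_compl] at h1
    linarith
  · have h1 := h' Xᶜ
    have h2 := hc X
    linarith

theorem compl_mem_tightSets_reflection (hy : y ∈ basePolyhedron f) {P : Finset N}
    (hP : P ∈ tightSets f y) : Pᶜ ∈ tightSets (reflection f) (-y) := by
  have hc := Finset.sum_add_sum_compl P y
  have h := hy.1
  simp only [tightSets, reflection, Set.mem_ofPred_eq, Pi.neg_apply, Finset.sum_neg_distrib,
    compl_compl, Int.cast_sub] at hP ⊢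
  linarith

/-- Inside the complement of a tight set `P` where `y` lies below an integer vector `a`, the
coordinate `y i` can be lowered to at most `a i - 1` while the other coordinates only increase and
stay below `a`. -/
theorem exists_lower (hf : IsSupermodular f) (hf0 : f ∅ = 0) (hy : y ∈ basePolyhedron f)
    {P : Finset N} (hP : P ∈ tightSets f y) (a : N → ℤ) (ha : ∀ k ∉ P, y k < (a k : ℝ))
    {i : N} (hi : i ∉ P) :
    ∃ w ∈ basePolyhedron f, (∀ k ∈ P, w k = y k) ∧
      (∀ k ∉ P, k ≠ i → y k ≤ w k ∧ w k ≤ (a k : ℝ)) ∧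
      y i - 1 < w i ∧ w i ≤ (a i : ℝ) - 1 := by
  obtain ⟨w, hw, h1, h2, h3, h4⟩ := exists_raise hf.reflection (by simp [reflection])
    ((neg_mem_basePolyhedron_reflection hf0).mpr hy) (compl_mem_tightSets_reflection hy hP)
    (fun k => -a k)
    (fun k hk => by simpa using ha k (Finset.mem_compl.mp hk)) (Finset.mem_compl.mpr hi)
  refine ⟨-w, (neg_mem_basePolyhedron_reflection hf0).mp (by rwa [neg_neg]), fun k hk => ?_,
    fun k hk hki => ?_, ?_, ?_⟩
  · have := h1 k (by simpa using hk)
    simp [this]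
  · have := h2 k (Finset.mem_compl.mpr hk) hki
    simp only [Int.cast_neg, Pi.neg_apply] at this ⊢
    exact ⟨by linarith, by linarith⟩
  · simp only [Pi.neg_apply] at h4 ⊢
    linarith
  · simp only [Int.cast_neg, Pi.neg_apply] at h3 ⊢
    linarith

/-! ### Contractions and first optimality conditions -/

/-- Contracting the coordinates towards a common value `c` while keeping their sum does not
increase a symmetric strictly convex function, and decreases it if a coordinate changes. -/
theorem apply_lt_of_contract {Φ : (N → ℝ) → ℝ} (hsymm : IsSymmetric Φ)
    (hconv : StrictConvexOn ℝ Set.univ Φ) (c : ℝ) {z z' : N → ℝ} (hsum : ∑ k, z' k = ∑ k, z k)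
    (h : ∀ k, (c ≤ z' k ∧ z' k ≤ z k) ∨ (z k ≤ z' k ∧ z' k ≤ c)) (hne : z' ≠ z) :
    Φ z' < Φ z := by
  induction hn : (Finset.univ.filter fun k => z' k ≠ z k).card using Nat.strong_induction_on
    generalizing z with
  | _ n ih =>
  have hex : ∃ i j, z' i < z i ∧ z j < z' j := by
    by_contra hno
    push Not at hno
    apply hne
    by_cases h1 : ∃ i, z' i < z i
    · obtain ⟨i, hi⟩ := h1
      have := Finset.sum_lt_sum (fun k _ => hno i k hi) ⟨i, Finset.mem_univ i, hi⟩
      linarith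
    · push Not at h1
      funext k
      exact ((Finset.sum_eq_sum_iff_of_le fun k _ => h1 k).mp hsum.symm k (Finset.mem_univ k)).symm
  obtain ⟨i, j, hi, hj⟩ := hex
  have hij : i ≠ j := by
    rintro rfl
    linarith
  have hic : c ≤ z' i := by
    rcases h i with h | h
    · exact h.1
    · linarith
  have hjc : z' j ≤ c := by
    rcases h j with h | h
    · linarith
    · exact h.2
  -- The largest transfer that overshoots neither target: at least one of i, j reaches its final
  -- value, so fewer coordinates differ.
  set δ := min (z i - z' i) (z' j - z j) with hδ
  have hδ0 : 0 < δ := lt_min (by linarith) (by linarith)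
  have hδ1 : δ ≤ z i - z' i := min_le_left _ _
  have hδ2 : δ ≤ z' j - z j := min_le_right _ _
  have hlt : Φ (transfer z i j δ) < Φ z := apply_transfer_lt hsymm hconv hδ0 (by linarith)
  have ti : transfer z i j δ i = z i - δ := by simp [transfer, hij.symm]
  have tj : transfer z i j δ j = z j + δ := by simp [transfer, hij]
  have tk : ∀ k, k ≠ i → k ≠ j → transfer z i j δ k = z k := fun k h1 h2 => by
    simp [transfer, h1.symm, h2.symm]
  rcases eq_or_ne z' (transfer z i j δ) with he | he
  · rwa [he]
  refine (ih _ ?_ (z := transfer z i j δ) ?_ ?_ he rfl).trans hlt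
  · rw [← hn]
    apply Finset.card_lt_card
    rw [Finset.ssubset_iff_of_subset]
    · rcases min_choice (z i - z' i) (z' j - z j) with hm | hm
      · refine ⟨i, by simp [hi.ne], ?_⟩
        simp only [Finset.mem_filter, Finset.mem_univ, true_and, not_not, ti]
        linarith
      · refine ⟨j, by simp [hj.ne'], ?_⟩
        simp only [Finset.mem_filter, Finset.mem_univ, true_and, not_not, tj]
        linarith
    · intro k hk
      simp only [Finset.mem_filter, Finset.mem_univ, true_and] at hk ⊢
      by_cases hki : k = i
      · rw [hki]; exact hi.ne
      by_cases hkj : k = j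
      · rw [hkj]; exact hj.ne'
      rwa [tk k hki hkj] at hk
  · rw [sum_transfer]
    simp [hsum]
  · intro k
    by_cases hki : k = i
    · rw [hki, ti]
      exact Or.inl ⟨hic, by linarith⟩
    by_cases hkj : k = j
    · rw [hkj, tj]
      exact Or.inr ⟨by linarith, hjc⟩
    rw [tk k hki hkj]
    exact h k

/-- If `x + y` minimizes a symmetric strictly convex function over `x + basePolyhedron f`, then
each upper level set of `x + y` is tight for `y`. -/
theorem mem_tightSets_of_isMinOn (hf : IsSupermodular f) (hf0 : f ∅ = 0)
    (hy : y ∈ basePolyhedron f) {Φ : (N → ℝ) → ℝ} (hsymm : IsSymmetric Φ)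
    (hconv : StrictConvexOn ℝ Set.univ Φ) (x : N → ℝ)
    (hmin : ∀ y' ∈ basePolyhedron f, Φ (x + y) ≤ Φ (x + y')) {A : Finset N}
    (hA : ∀ i ∈ A, ∀ j ∉ A, (x + y) j < (x + y) i) : A ∈ tightSets f y := by
  obtain ⟨X, hX, hAX, hXA⟩ := exists_tight_separating hf hf0 hy A Aᶜ (by
    intro i hi j hj
    by_contra hno
    have hlt := hA i hi j (Finset.mem_compl.mp hj)
    have hij : i ≠ j := by
      rintro rfl
      exact lt_irrefl _ hlt
    obtain ⟨ε, hε, hex⟩ := exists_transfer_mem_basePolyhedron hy hij hno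
    -- Halving the gap keeps the transfer strictly short of swapping the two coordinates.
    set δ := min ε (((x + y) i - (x + y) j) / 2) with hδ
    have hδ0 : 0 < δ := lt_min hε (by linarith)
    have hδ1 : δ ≤ ((x + y) i - (x + y) j) / 2 := min_le_right _ _
    have h1 := hmin _ (hex δ hδ0.le (min_le_left _ _))
    have h2 := apply_transfer_lt hsymm hconv (z := x + y) (i := i) (j := j) hδ0 (by linarith)
    have h3 : transfer (x + y) i j δ = x + transfer y i j δ := by
      funext k
      simp only [transfer, Pi.add_apply]
      ring
    rw [h3] at h2
    linarith)
  have : X = A := subset_antisymm (fun k hk => by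
    by_contra hkA
    exact Finset.disjoint_left.mp hXA hk (Finset.mem_compl.mpr hkA)) hAX
  rwa [← this]

end

/-! ### Minors and the tight set at an integer level -/

/-- Between two tight sets `U ⊆ P`, a vector of the base-polyhedron can be replaced by any vector of
the base-polyhedron of the corresponding minor. -/
theorem replace_mem_basePolyhedron {N : Type*} [Fintype N] [DecidableEq N] {f : Finset N → ℤ}
    {y : N → ℝ} (hf : IsSupermodular f) (hy : y ∈ basePolyhedron f) {U P : Finset N} (hUP : U ⊆ P)
    (hU : U ∈ tightSets f y) (hP : P ∈ tightSets f y) (v : N → ℝ)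
    (hv : ∀ X ⊆ P \ U, (f (X ∪ U) : ℝ) - f U ≤ ∑ k ∈ X, v k)
    (hvs : ∑ k ∈ P \ U, v k = ∑ k ∈ P \ U, y k) :
    (fun k => if k ∈ P \ U then v k else y k) ∈ basePolyhedron f := by
  set q : N → ℝ := fun k => if k ∈ P \ U then v k else y k with hq
  have hin : ∀ X ⊆ P \ U, ∑ k ∈ X, q k = ∑ k ∈ X, v k := fun X hX =>
    Finset.sum_congr rfl fun k hk => if_pos (hX hk)
  have hout : ∀ X, Disjoint X (P \ U) → ∑ k ∈ X, q k = ∑ k ∈ X, y k := fun X hX =>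
    Finset.sum_congr rfl fun k hk => if_neg (Finset.disjoint_left.mp hX hk)
  have hsup : ∀ X, P \ U ⊆ X → ∑ k ∈ X, q k = ∑ k ∈ X, y k := fun X hX => by
    rw [← Finset.sum_sdiff hX, ← Finset.sum_sdiff hX, hin _ subset_rfl, hvs,
      hout _ Finset.sdiff_disjoint]
  have hdisj : ∀ X ⊆ U, ∑ k ∈ X, q k = ∑ k ∈ X, y k := fun X hX =>
    hout X (Finset.disjoint_sdiff.mono_left hX)
  have hUq : ∑ k ∈ U, q k = f U := (hdisj U subset_rfl).trans hU
  have hPq : ∑ k ∈ P, q k = f P := (hsup P Finset.sdiff_subset).trans hP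
  refine ⟨(hsup _ (Finset.subset_univ _)).trans hy.1, fun X => ?_⟩
  -- Uncrossing X with U and then with P leaves three sets: one inside U, one containing P, and one
  -- between U and P. The first two are controlled by y, the last by v.
  have h1 := hf.slack_le q X U
  have h2 := hf.slack_le q (X ∪ U) P
  have h3 := hy.2 (X ∩ U)
  rw [← hdisj _ Finset.inter_subset_right] at h3
  have h4 := hy.2 (X ∪ U ∪ P)
  rw [← hsup _ (Finset.sdiff_subset.trans Finset.subset_union_right)] at h4
  have hsub : ((X ∪ U) ∩ P) \ U ⊆ P \ U :=
    Finset.sdiff_subset_sdiff Finset.inter_subset_right subset_rfl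
  have hUs : U ⊆ (X ∪ U) ∩ P := Finset.subset_inter Finset.subset_union_right hUP
  have h5 := hv _ hsub
  rw [Finset.sdiff_union_of_subset hUs, ← hin _ hsub] at h5
  have h6 := Finset.sum_sdiff hUs (f := q)
  linarith

/-- For a minimizer `z` of a symmetric strictly convex function over the mixed set and every integer
`β`, a set that is tight for `z` separates the coordinates above `β` from those below `β`. -/
theorem exists_tight_level {N : Type*} [Fintype N] [DecidableEq N] {fM fC : Finset N → ℤ}
    (hM : IsSupermodular fM) (hM0 : fM ∅ = 0) (hC : IsSupermodular fC) (hC0 : fC ∅ = 0)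
    {Φ : (N → ℝ) → ℝ} (hsymm : IsSymmetric Φ) (hconv : StrictConvexOn ℝ Set.univ Φ)
    {z : N → ℝ} (hz : z ∈ mixedSet fM fC) (hmin : IsMinOn Φ (mixedSet fM fC) z) (β : ℤ) :
    ∃ X ∈ tightSets (fun X => fM X + fC X) z,
      (∀ i, (β : ℝ) < z i → i ∈ X) ∧ ∀ i, z i < (β : ℝ) → i ∉ X := by
  obtain ⟨x, ⟨hx, hxint⟩, y, hy, rfl⟩ := hz
  have hmin' : ∀ x' ∈ mConvexSet fM, ∀ y' ∈ basePolyhedron fC, Φ (x + y) ≤ Φ (x' + y') :=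
    fun x' hx' y' hy' => hmin ⟨x', hx', y', hy', rfl⟩
  have hxM : x ∈ mConvexSet fM := ⟨hx, hxint⟩
  choose a ha using hxint
  set U : Finset N := Finset.univ.filter fun k => (β : ℝ) < x k + y k with hUdef
  set P : Finset N := Finset.univ.filter fun k => (β : ℝ) ≤ x k + y k with hPdef
  have memU : ∀ k, k ∈ U ↔ (β : ℝ) < x k + y k := fun k => by simp [hUdef]
  have memP : ∀ k, k ∈ P ↔ (β : ℝ) ≤ x k + y k := fun k => by simp [hPdef]
  have hUP : U ⊆ P := fun k hk => (memP k).mpr ((memU k).mp hk).le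
  have hU : U ∈ tightSets fC y :=
    mem_tightSets_of_isMinOn hC hC0 hy hsymm hconv x (hmin' x hxM) fun i hi j hj =>
      (not_lt.mp fun h => hj ((memU j).mpr h)).trans_lt ((memU i).mp hi)
  have hP : P ∈ tightSets fC y :=
    mem_tightSets_of_isMinOn hC hC0 hy hsymm hconv x (hmin' x hxM) fun i hi j hj =>
      (not_le.mp fun h => hj ((memP j).mpr h)).trans_le ((memP i).mp hi)
  set W := P \ U with hW
  have hWU : W ∪ U = P := Finset.sdiff_union_of_subset hUP
  have memW : ∀ k ∈ W, x k + y k = β := fun k hk => by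
    obtain ⟨h1, h2⟩ := Finset.mem_sdiff.mp hk
    exact le_antisymm (not_lt.mp fun h => h2 ((memU k).mpr h)) ((memP k).mp h1)
  -- On W this is the minor of `fC` between U and P; off W it is modular and prescribes the values
  -- -a.
  set h : Finset N → ℤ := fun X => fC (X ∩ W ∪ U) - fC U - ∑ k ∈ X \ W, a k with hh
  have hhsup : IsSupermodular h := by
    intro X Y
    have h1 := hC (X ∩ W ∪ U) (Y ∩ W ∪ U)
    have e1 : X ∩ W ∪ U ∪ (Y ∩ W ∪ U) = (X ∪ Y) ∩ W ∪ U := by grind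
    have e2 : (X ∩ W ∪ U) ∩ (Y ∩ W ∪ U) = X ∩ Y ∩ W ∪ U := by grind
    have h2 := Finset.sum_union_inter (f := a) (s₁ := X \ W) (s₂ := Y \ W)
    have e3 : X \ W ∪ Y \ W = (X ∪ Y) \ W := by grind
    have e4 : X \ W ∩ (Y \ W) = (X ∩ Y) \ W := by grind
    rw [e3, e4] at h2
    rw [e1, e2] at h1
    simp only [hh]
    linarith
  have hh0 : h ∅ = 0 := by simp [hh]
  have hsumx : ∀ X : Finset N, ∑ k ∈ X, x k = ((∑ k ∈ X, a k : ℤ) : ℝ) := fun X => by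
    rw [Int.cast_sum]
    exact Finset.sum_congr rfl fun k _ => ha k
  set v : N → ℝ := fun k => if k ∈ W then y k else -x k with hv
  have hvsum : ∀ X : Finset N, ∑ k ∈ X, v k = ∑ k ∈ X ∩ W, y k - ∑ k ∈ X \ W, x k := fun X => by
    rw [← Finset.sum_inter_add_sum_sdiff X W v, sub_eq_add_neg, ← Finset.sum_neg_distrib]
    exact congrArg₂ _
      (Finset.sum_congr rfl fun k hk => if_pos (Finset.mem_inter.mp hk).2)
      (Finset.sum_congr rfl fun k hk => if_neg (Finset.mem_sdiff.mp hk).2)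
  have hdWU : ∀ X : Finset N, Disjoint (X ∩ W) U := fun X =>
    Finset.sdiff_disjoint.mono_left Finset.inter_subset_right
  have hyU : ∑ k ∈ U, y k = fC U := hU
  have hyP : ∑ k ∈ P, y k = fC P := hP
  have hvB : v ∈ basePolyhedron h := by
    refine ⟨?_, fun X => ?_⟩
    · rw [hvsum, hsumx]
      simp only [hh, Finset.univ_inter, hWU]
      have := Finset.sum_sdiff hUP (f := y)
      push_cast
      linarith
    · rw [hvsum, hsumx]
      have h1 := hy.2 (X ∩ W ∪ U)
      rw [Finset.sum_union (hdWU X)] at h1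
      simp only [hh]
      push_cast
      linarith
  have hxv : x + v ∈ basePolyhedron fun X => fM X + h X := by
    refine ⟨?_, fun X => ?_⟩
    · simp only [Pi.add_apply, Finset.sum_add_distrib, hx.1, hvB.1, Int.cast_add]
    · simp only [Pi.add_apply, Finset.sum_add_distrib, Int.cast_add]
      exact add_le_add (hx.2 X) (hvB.2 X)
  have hsupE : IsSupermodular fun X => fM X + h X := fun X Y => by
    have := hM X Y
    have := hhsup X Y
    dsimp only
    linarith
  by_cases hsep : ∀ i ∈ U, ∀ j ∈ Pᶜ, ∃ X ∈ tightSets (fun X => fM X + h X) (x + v), i ∈ X ∧ j ∉ X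
  · obtain ⟨X, hX, hUX, hXP⟩ :=
      exists_tight_separating hsupE (by simp [hM0, hh0]) hxv U Pᶜ hsep
    refine ⟨X, ?_, fun i hi => hUX ((memU i).mpr hi), fun i hi hiX =>
      Finset.disjoint_left.mp hXP hiX (Finset.mem_compl.mpr fun h => ?_)⟩
    -- Because U ⊆ X ⊆ P, the terms in a cancel and the slack of v for `h` on X equals that of y for
    -- `fC`. Tightness at x + v therefore passes to x + y.
    · have hXW : X ∩ W ∪ U = X := by
        ext k
        have h1 := @hUX k
        have h2 : k ∈ X → k ∈ P := fun hk => by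
          by_contra hkP
          exact Finset.disjoint_left.mp hXP hk (Finset.mem_compl.mpr hkP)
        grind
      have h1 := hx.2 X
      have h2 := hvB.2 X
      have h3 : ∑ k ∈ X, (x + v) k = ((fM X + h X : ℤ) : ℝ) := hX
      simp only [Pi.add_apply, Finset.sum_add_distrib] at h3
      have h4 : ∑ k ∈ X, y k = ∑ k ∈ X ∩ W, y k + ∑ k ∈ U, y k := by
        rw [← Finset.sum_union (hdWU X), hXW]
      have h5 := hvsum X
      rw [hsumx (X \ W)] at h5
      simp only [hh, hXW] at h2 h3
      simp only [tightSets, Set.mem_ofPred_eq, Pi.add_apply, Finset.sum_add_distrib]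
      push_cast at h2 h3 h5 ⊢
      linarith
    · exact absurd ((memP i).mp h) (not_le.mpr hi)
  exfalso
  push Not at hsep
  obtain ⟨i, hi, j, hj, hij⟩ := hsep
  have hjP : j ∉ P := Finset.mem_compl.mp hj
  have hiW : i ∉ W := fun h => (Finset.mem_sdiff.mp h).2 hi
  have hjW : j ∉ W := fun h => hjP (Finset.mem_sdiff.mp h).1
  have hjU : j ∉ U := fun h => hjP (hUP h)
  have hne : i ≠ j := fun h => hjU (h ▸ hi)
  set b : N → ℤ := fun k => if k ∈ W then β else 0 with hb
  have hxvb : ∀ k, (x + v) k = b k := fun k => by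
    by_cases hk : k ∈ W
    · simp only [Pi.add_apply, hv, hb, hk, if_true]
      exact memW k hk
    · simp [hv, hb, hk]
  have hw : transfer (x + v) i j 1 ∈ mConvexSet fun X => fM X + h X := by
    refine ⟨transfer_mem_basePolyhedron hxv zero_le_one fun X hiX hjX => ?_, fun k => ?_⟩
    -- The point x + v is integral, so a nonzero slack is at least 1 and a full unit can be moved.
    · have h1 := hxv.2 X
      have h2 : ∑ k ∈ X, (x + v) k ≠ ((fM X + h X : ℤ) : ℝ) := fun h => hjX (hij X h hiX)
      have h3 : ∑ k ∈ X, (x + v) k = ((∑ k ∈ X, b k : ℤ) : ℝ) := by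
        rw [Int.cast_sum]
        exact Finset.sum_congr rfl fun k _ => hxvb k
      rw [h3] at h1 h2 ⊢
      exact_mod_cast lt_of_le_of_ne (Int.cast_le.mp h1) fun h => h2 (congrArg Int.cast h.symm)
    · refine ⟨b k + (if j = k then 1 else 0) - (if i = k then 1 else 0), ?_⟩
      simp only [transfer, hxvb]
      push_cast
      rfl
  rw [← mixedSet_inter_integerVectors hM hM0 hhsup hh0] at hw
  obtain ⟨⟨x', hx', v', hv', he⟩, -⟩ := hw
  -- As `h` is modular off W, the bounds on {k} and on its complement force the value at k.
  have hv'out : ∀ k ∉ W, v' k = -x k := fun k hk => by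
    have h1 := hv'.2 {k}
    have h2 := hv'.2 (Finset.univ.erase k)
    have h3 := Finset.add_sum_erase Finset.univ v' (Finset.mem_univ k)
    rw [hv'.1] at h3
    have e1 : ({k} : Finset N) ∩ W = ∅ := by grind
    have e2 : ({k} : Finset N) \ W = {k} := by grind
    have e3 : Finset.univ.erase k ∩ W = W := by grind
    have e4 : Finset.univ.erase k \ W = (Finset.univ \ W).erase k := by grind
    have h4 := Finset.add_sum_erase (Finset.univ \ W) a
      (Finset.mem_sdiff.mpr ⟨Finset.mem_univ k, hk⟩)
    have h4' : (a k : ℝ) + ((∑ m ∈ (Finset.univ \ W).erase k, a m : ℤ) : ℝ) =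
        ((∑ m ∈ Finset.univ \ W, a m : ℤ) : ℝ) := by exact_mod_cast h4
    simp only [hh, e1, e2, e3, e4, Finset.sum_singleton, Finset.empty_union,
      Finset.univ_inter] at h1 h2 h3
    rw [ha k]
    push_cast at h1 h2 h3 h4' ⊢
    linarith
  have hx'k : ∀ k, x' k = transfer (x + v) i j 1 k - v' k := fun k => by
    rw [he]
    simp
  have hx'W : ∀ k ∈ W, x' k = β - v' k := fun k hk => by
    have h1 : i ≠ k := fun h => hiW (h ▸ hk)
    have h2 : j ≠ k := fun h => hjW (h ▸ hk)
    rw [hx'k]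
    simp [transfer, h1, h2, hv, hk, memW k hk]
  have hx'out : ∀ k ∉ W, x' k = x k + (if j = k then 1 else 0) - (if i = k then 1 else 0) :=
    fun k hk => by
      rw [hx'k, hv'out k hk]
      simp only [transfer, Pi.add_apply, hv, hk, if_false]
      ring
  -- Since x' i = a i - 1, raising y to at least β - a i + 1 at i keeps the sum at least β; a rise
  -- of less than 1 makes the sum strictly smaller than before.
  obtain ⟨y₁, hy₁, y₁off, y₁on, y₁i, y₁i'⟩ := exists_raise hC hC0 hy hU (fun k => β - a k)
    (fun k hk => by
      have := (memU k).mp hk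
      rw [ha k] at this
      push_cast
      linarith) hi
  have htight : ∀ Q : Finset N, U ⊆ Q → Q ∈ tightSets fC y → Q ∈ tightSets fC y₁ := by
    intro Q hUQ hQ
    have h1 := Finset.sum_add_sum_compl Q y
    have h2 := Finset.sum_add_sum_compl Q y₁
    have h3 : ∑ k ∈ Qᶜ, y₁ k = ∑ k ∈ Qᶜ, y k :=
      Finset.sum_congr rfl fun k hk => y₁off k fun h => Finset.mem_compl.mp hk (hUQ h)
    have h4 := hy.1
    have h5 := hy₁.1
    simp only [tightSets, Set.mem_ofPred_eq] at hQ ⊢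
    linarith
  have hU₁ := htight U subset_rfl hU
  have hP₁ := htight P hUP hP
  have offP : ∀ k ∉ P, y₁ k = y k := fun k hk => y₁off k fun h => hk (hUP h)
  obtain ⟨y₂, hy₂, y₂off, y₂on, y₂j, y₂j'⟩ := exists_lower hC hC0 hy₁ hP₁ (fun k => β - a k)
    (fun k hk => by
      have := not_le.mp fun h => hk ((memP k).mpr h)
      rw [ha k] at this
      rw [offP k hk]
      push_cast
      linarith) hjP
  have htight₂ : ∀ Q ⊆ P, ∑ k ∈ Q, y₂ k = ∑ k ∈ Q, y₁ k := fun Q hQ =>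
    Finset.sum_congr rfl fun k hk => y₂off k (hQ hk)
  have hU₂ : U ∈ tightSets fC y₂ := (htight₂ U hUP).trans hU₁
  have hP₂ : P ∈ tightSets fC y₂ := (htight₂ P subset_rfl).trans hP₁
  have hv'sub : ∀ X ⊆ W, (fC (X ∪ U) : ℝ) - fC U ≤ ∑ k ∈ X, v' k := fun X hX => by
    have h1 := hv'.2 X
    simp only [hh, Finset.inter_eq_left.mpr hX, Finset.sdiff_eq_empty_iff_subset.mpr hX,
      Finset.sum_empty, sub_zero] at h1
    exact_mod_cast h1
  have hv'W : ∑ k ∈ W, v' k = ∑ k ∈ W, y₂ k := by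
    have h1 := hv'.1
    rw [← Finset.sum_sdiff (Finset.subset_univ W)] at h1
    have h2 : ∑ k ∈ Finset.univ \ W, v' k = -∑ k ∈ Finset.univ \ W, x k := by
      rw [← Finset.sum_neg_distrib]
      exact Finset.sum_congr rfl fun k hk => hv'out k (Finset.mem_sdiff.mp hk).2
    rw [h2, hsumx] at h1
    simp only [hh, Finset.univ_inter, hWU] at h1
    have h3 := Finset.sum_sdiff hUP (f := y₂)
    have h4 : ∑ k ∈ U, y₂ k = fC U := hU₂
    have h5 : ∑ k ∈ P, y₂ k = fC P := hP₂
    push_cast at h1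
    linarith
  have hy₃ := replace_mem_basePolyhedron hC hy₂ hUP hU₂ hP₂ v' hv'sub hv'W
  set y₃ : N → ℝ := fun k => if k ∈ W then v' k else y₂ k with hy₃def
  have y₃i : y₃ i = y₁ i := by
    simp only [hy₃def, hiW, if_false]
    exact y₂off i (hUP hi)
  have y₃j : y₃ j = y₂ j := by simp only [hy₃def, hjW, if_false]
  push_cast at y₁i y₁on y₂j' y₂on
  have hlt : Φ (x' + y₃) < Φ (x + y) := by
    -- Sums in U fall but stay at least β, sums outside P rise but stay at most β, and sums on W
    -- remain β. The strict drop at i rules out equality.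
    refine apply_lt_of_contract hsymm hconv β ?_ (fun k => ?_) fun heq => ?_
    · simp only [Pi.add_apply, Finset.sum_add_distrib, hx'.1.1, hx.1, hy₃.1, hy.1]
    · simp only [Pi.add_apply]
      by_cases hkW : k ∈ W
      · left
        rw [hx'W k hkW, memW k hkW]
        simp [hy₃def, hkW]
      rw [hx'out k hkW, show y₃ k = y₂ k by simp only [hy₃def, hkW, if_false]]
      by_cases hkU : k ∈ U
      · left
        have hjk : j ≠ k := fun h => hjU (h ▸ hkU)
        rw [y₂off k (hUP hkU)]
        by_cases hik : i = k
        · subst hik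
          simp only [hjk, if_false, if_true, ha i]
          exact ⟨by linarith, by linarith⟩
        · have := y₁on k hkU (Ne.symm hik)
          simp only [hjk, hik, if_false, ha k]
          exact ⟨by linarith, by linarith⟩
      · right
        have hkP : k ∉ P := fun h => hkW (Finset.mem_sdiff.mpr ⟨h, hkU⟩)
        have hik : i ≠ k := fun h => hkU (h ▸ hi)
        rw [← offP k hkP]
        by_cases hjk : j = k
        · subst hjk
          simp only [hik, if_false, if_true, ha j]
          exact ⟨by linarith, by linarith⟩
        · have := y₂on k hkP (Ne.symm hjk)
          simp only [hjk, hik, if_false, ha k]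
          exact ⟨by linarith, by linarith⟩
    · have := congrFun heq i
      simp only [Pi.add_apply, y₃i, hx'out i hiW, hne.symm, if_false, if_true] at this
      linarith
  exact absurd (hmin' x' hx' y₃ hy₃) (not_le.mpr hlt)

/-! ### From tight sets to maximizers -/

/-- If a tight set `X` separates the coordinates of `z` above `β` from those below `β`, then so does
every maximizer of `f(Y) - β|Y|`. -/
theorem separates_of_mem_maximizers {N : Type*} [Fintype N] [DecidableEq N] {f : Finset N → ℤ}
    {z : N → ℝ} (hz : ∀ X, (f X : ℝ) ≤ ∑ i ∈ X, z i) {β : ℤ} {X Y : Finset N}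
    (hX : X ∈ tightSets f z) (hup : ∀ i, (β : ℝ) < z i → i ∈ X) (hlow : ∀ i, z i < (β : ℝ) → i ∉ X)
    (hY : Y ∈ maximizers f β) :
    (∀ i, (β : ℝ) < z i → i ∈ Y) ∧ ∀ i, z i < (β : ℝ) → i ∉ Y := by
  have hsum : ∀ S : Finset N,
      ∑ k, (if k ∈ S then z k - β else 0) = ∑ k ∈ S, z k - β * S.card := fun S => by
    rw [Finset.sum_ite_mem, Finset.univ_inter, Finset.sum_sub_distrib, Finset.sum_const,
      nsmul_eq_mul, mul_comm]
  have hle : ∑ k, (if k ∈ X then z k - β else 0) ≤ ∑ k, (if k ∈ Y then z k - β else 0) := by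
    have h1 : (f X : ℝ) - β * X.card ≤ f Y - β * Y.card := by exact_mod_cast hY X
    have h2 : ∑ i ∈ X, z i = f X := hX
    have h3 := hz Y
    rw [hsum, hsum]
    linarith
  -- X collects all positive terms z k - β and no negative ones, so it dominates Y term by term.
  -- Combined with `hle` this forces termwise equality.
  have hpt : ∀ k ∈ Finset.univ,
      (if k ∈ Y then z k - β else 0) ≤ (if k ∈ X then z k - β else 0) := fun k _ => by
    have h1 := hup k
    have h2 := hlow k
    grind
  have heq := (Finset.sum_eq_sum_iff_of_le hpt).mp (le_antisymm (Finset.sum_le_sum hpt) hle)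
  refine ⟨fun i hi => ?_, fun i hi hiY => ?_⟩
  · by_contra hiY
    have := heq i (Finset.mem_univ i)
    simp only [hiY, hup i hi, if_true, if_false] at this
    linarith
  · have := heq i (Finset.mem_univ i)
    simp only [hiY, hlow i hi, if_true, if_false] at this
    linarith

theorem lemma4p9 {N : Type*} [Fintype N] [DecidableEq N]
    (fM fC : Finset N → ℤ)
    (hM : IsSupermodular fM) (hM0 : fM ∅ = 0)
    (hC : IsSupermodular fC) (hC0 : fC ∅ = 0)
    (Φ : (N → ℝ) → ℝ) (hsymm : IsSymmetric Φ) (hconv : StrictConvexOn ℝ Set.univ Φ)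
    (z : N → ℝ) (hz : z ∈ mixedSet fM fC) (hmin : IsMinOn Φ (mixedSet fM fC) z) :
    ∀ β ∈ essentialValues (fun X => fM X + fC X),
      ∀ i ∈ canonicalPart (fun X => fM X + fC X) β,
        (β : ℝ) - 1 ≤ z i ∧ z i ≤ (β : ℝ) := by

  intro β _ i hi
  have hE : IsSupermodular fun X => fM X + fC X := fun X Y => by
    have := hM X Y
    have := hC X Y
    dsimp only
    linarith
  have hlow : ∀ X, ((fM X + fC X : ℤ) : ℝ) ≤ ∑ k ∈ X, z k := fun X => by
    obtain ⟨x, ⟨⟨-, hx⟩, -⟩, y, ⟨-, hy⟩, rfl⟩ := hz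
    simp only [Pi.add_apply, Finset.sum_add_distrib, Int.cast_add]
    exact add_le_add (hx X) (hy X)
  have hsep : ∀ γ : ℤ, (∀ k, (γ : ℝ) < z k → k ∈ smallestMaximizer (fun X => fM X + fC X) γ) ∧
      ∀ k, z k < (γ : ℝ) → k ∉ smallestMaximizer (fun X => fM X + fC X) γ := fun γ => by
    obtain ⟨X, hX, hup, hdown⟩ := exists_tight_level hM hM0 hC hC0 hsymm hconv hz hmin γ
    exact separates_of_mem_maximizers hlow hX hup hdown (isLeast_smallestMaximizer hE γ).1
  obtain ⟨h1, h2⟩ := Finset.mem_sdiff.mp hi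
  refine ⟨?_, ?_⟩
  · by_contra h
    exact (hsep (β - 1)).2 i (by push_cast; linarith) h1
  · by_contra h
    exact h2 ((hsep β).1 i (not_le.mp h))
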